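/- Let $R$ be an associative ring with identity that is von Neumann regular (for every $a\in R$ there is $b\in R$ with $aba=a$). Then the following conditions are equivalent: 1) Every right $R$-module $M$ is an $I_0$-module, that is, every submodule of $M$ that is not small in $M$ contains a nonzero direct summand of $M$ (a submodule $N$ of $M$ is small if $N+X=M$ implies $X=M$ for every submodule $X$ of $M$). 2) $R$ is a right $SV$-ring, that is, the right module $R_R$ is semiartinian and is a $V$-module. Here a module $M$ is semiartinian if $\operatorname{Soc}_\alpha(M)=M$ for some ordinal $\alpha$, where $\operatorname{Soc}_0(M)=0$, $\operatorname{Soc}_{\alpha+1}(M)/\operatorname{Soc}_\alpha(M)$ is the socle (the sum of all simple submodules) of $M/\operatorname{Soc}_\alpha(M)$, and $\operatorname{Soc}_\alpha(M)=\bigcup_{\beta<\alpha}\operatorname{Soc}_\beta(M)$ for limit ordinals $\alpha$; and $M$ is a $V$-module if every proper submodule of $M$ is an intersection of maximal submodules of $M$. 3) Every right $R$-module is almost projective. 4) Every simple right $R$-module is almost projective. Here a right $R$-module $M$ is almost projective if for every right $R$-module $N$, every submodule $K$ of $N$ with natural homomorphism $g:N\to N/K$, and every homomorphism $f:M\to N/K$,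 either there is a homomorphism $h:M\to N$ with $f=gh$, or there are a nonzero direct summand $N'$ of $N$ and a homomorphism $h':N'\to M$ with $g\iota=fh'$, where $\iota:N'\to N$ is the inclusion. -/

import Mathlib

universe u v

/-- A ring is von Neumann regular if every element `a` satisfies `a = a * b * a` for some `b`. -/
def IsVonNeumannRegularRing (R : Type u) [Ring R] : Prop :=
  ∀ a : R, ∃ b : R, a * b * a = a

namespace Module

section

variable (A : Type u) [Ring A] (M : Type v) [AddCommGroup M] [Module A M]

/-- `N` is a small (superfluous) submodule: `N + X = M` implies `X = M`. -/
def IsSmallSubmodule {A : Type u} [Ring A] {M : Type v} [AddCommGroup M] [Module A M]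
    (N : Submodule A M) : Prop :=
  ∀ X : Submodule A M, N ⊔ X = ⊤ → X = ⊤

/-- `N` is a direct summand: it has a complementary submodule. -/
def IsDirectSummand {A : Type u} [Ring A] {M : Type v} [AddCommGroup M] [Module A M]
    (N : Submodule A M) : Prop :=
  ∃ C : Submodule A M, IsCompl N C

/-- `M` is an `I₀`-module: every nonsmall submodule contains a nonzero direct summand of `M`. -/
def IsI0Module : Prop :=
  ∀ N : Submodule A M, ¬ IsSmallSubmodule N →
    ∃ D : Submodule A M, D ≤ N ∧ D ≠ ⊥ ∧ IsDirectSummand D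

/-- `M` is almost `N`-projective: for every submodule `K` of `N` with natural map
`g : N → N / K` and every `f : M → N / K`, either `f` lifts along `g`, or there are a nonzero
direct summand `N'` of `N` and `h' : N' → M` such that `g` restricted to `N'` is `f ∘ h'`. -/
def IsAlmostProjectiveTo (N : Type v) [AddCommGroup N] [Module A N] : Prop :=
  ∀ (K : Submodule A N) (f : M →ₗ[A] N ⧸ K),
    (∃ h : M →ₗ[A] N, f = K.mkQ ∘ₗ h) ∨
      ∃ N' : Submodule A N, N' ≠ ⊥ ∧ IsDirectSummand N' ∧
        ∃ h' : N' →ₗ[A] M, K.mkQ ∘ₗ N'.subtype = f ∘ₗ h'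

/-- `M` is almost projective: almost `N`-projective for every module `N`. -/
def IsAlmostProjective : Prop :=
  ∀ (N : Type v) [AddCommGroup N] [Module A N], IsAlmostProjectiveTo A M N

/-- The socle: the sum of all simple submodules. -/
def socle : Submodule A M :=
  sSup {S : Submodule A M | IsSimpleModule A S}

/-- The Loewy series: `Soc₀ = 0`, `Soc_{α+1} / Soc_α = Soc (M / Soc_α)`, and unions at limit
ordinals (the supremum of a chain of submodules is its union). -/
noncomputable def loewySeries (α : Ordinal.{v}) : Submodule A M :=
  Ordinal.limitRecOn (motive := fun _ => Submodule A M) α ⊥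
    (fun _ S => (socle A (M ⧸ S)).comap S.mkQ)
    (fun β _ S => ⨆ γ : Set.Iio β, S γ.1 γ.2)

/-- `M` is semiartinian: its Loewy series reaches `M`. -/
def IsSemiartinian : Prop :=
  ∃ α : Ordinal.{v}, loewySeries A M α = ⊤

/-- `M` is a `V`-module: every proper submodule is an intersection of maximal submodules. -/
def IsVModule : Prop :=
  ∀ N : Submodule A M, N ≠ ⊤ → ∃ s : Set (Submodule A M), (∀ P ∈ s, IsCoatom P) ∧ sInf s = N

end

end Module

/-- `R` is a right `SV`-ring: the right module `R_R` (that is, `R` as a module over the opposite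
ring) is semiartinian and a `V`-module. -/
def IsRightSVRing (R : Type u) [Ring R] : Prop :=
  Module.IsSemiartinian Rᵐᵒᵖ R ∧ Module.IsVModule Rᵐᵒᵖ R

/-!
Write `(∗)` for: every finitely generated module is semisimple or contains a nonzero injective
submodule.

A finitely generated module `M` that is not semisimple has an essential maximal submodule `K`. Let
`E` be an injective module containing `M`. The `I₀`-property of `E × M ⧸ K`, applied to the range
of `(i, mkQ) : M → E × M ⧸ K`, or almost projectivity of `M ⧸ K` relative to `E`, applied to
`M ⧸ K → E ⧸ K`, yields a nonzero injective submodule of `M`; so (1) and (4) each imply `(∗)`.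

Assume `(∗)` over a regular ring. By an argument of Osofsky, an injective finitely generated
quasi-projective module in which finitely generated submodules are summands is Noetherian: otherwise
some countably generated `I` that is not finitely generated may be taken essential in `P`, it is a
direct sum of summands `Q n` of `P`, and splitting `ℕ` into infinitely many infinite blocks shows
that `P ⧸ I` is not Noetherian and neither it nor any nonzero submodule of it is injective. Hence
quotients of the ring by two-sided ideals have simple submodules, and the ring is semiartinian.
If a simple module `S` were not injective, a homomorphism to `S` from a left ideal that does not
extend would produce `z : ℕ → S` whose span is not Noetherian, hence contains a nonzero injective
`D ≤ ℕ → S`; a simple submodule of the ring modulo the reject of `S` then embeds in `D` and maps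
isomorphically onto `S`, so that `S` is a retract of `D`. Thus every simple module is injective,
which is the `V`-property.

Conversely, over an `SV`-ring every nonzero submodule contains a simple one, and it is an injective
direct summand.
-/

namespace SVRing

open Module

section DirectSummands

variable {A : Type u} [Ring A] {M : Type v} [AddCommGroup M] [Module A M] {N : Submodule A M}

theorem isDirectSummand_iff_exists_isProj :
    IsDirectSummand N ↔ ∃ p : M →ₗ[A] M, LinearMap.IsProj N p := by
  refine ⟨fun ⟨C, hC⟩ => ⟨N.subtype ∘ₗ N.projectionOnto C hC, fun x => by simp, fun x hx => ?_⟩,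
    fun ⟨p, hp⟩ => ⟨LinearMap.ker p, hp.isCompl⟩⟩
  exact congrArg Subtype.val (Submodule.projectionOnto_apply_left hC ⟨x, hx⟩)

theorem exists_retraction_of_isDirectSummand (h : IsDirectSummand N) :
    ∃ r : M →ₗ[A] N, ∀ x : N, r x = x := by
  obtain ⟨p, hp⟩ := isDirectSummand_iff_exists_isProj.1 h
  exact ⟨hp.codRestrict, hp.codRestrict_apply_cod⟩

theorem isDirectSummand_of_retraction (r : M →ₗ[A] N) (hr : ∀ x : N, r x = x) :
    IsDirectSummand N :=
  ⟨LinearMap.ker r, LinearMap.isCompl_of_proj hr⟩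

theorem finite_of_isDirectSummand [Module.Finite A M] (h : IsDirectSummand N) :
    Module.Finite A N := by
  obtain ⟨r, hr⟩ := exists_retraction_of_isDirectSummand h
  exact Module.Finite.of_surjective r fun x => ⟨x, hr x⟩

end DirectSummands

section Essential

variable {A : Type u} [Ring A] {M : Type v} [AddCommGroup M] [Module A M]

/-- `X` is an essential submodule: it meets every nonzero submodule. -/
def IsEssential (X : Submodule A M) : Prop :=
  ∀ W, Disjoint X W → W = ⊥

theorem IsEssential.mono {X Y : Submodule A M} (hX : IsEssential X) (h : X ≤ Y) :
    IsEssential Y :=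
  fun W hW => hX W (hW.mono_left h)

theorem map_subtype_eq_bot_iff {N : Submodule A M} {W : Submodule A N} :
    W.map N.subtype = ⊥ ↔ W = ⊥ := by
  rw [← LinearMap.le_ker_iff_map, Submodule.ker_subtype, le_bot_iff]

theorem disjoint_map_subtype {X N : Submodule A M} {W : Submodule A N}
    (h : Disjoint (X.comap N.subtype) W) : Disjoint X (W.map N.subtype) := by
  rw [Submodule.disjoint_def] at h ⊢
  rintro _ hx ⟨w, hw, rfl⟩
  exact congrArg Subtype.val (h w hx hw)

theorem IsEssential.comap_subtype {X : Submodule A M} (hX : IsEssential X)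
    (N : Submodule A M) : IsEssential (X.comap N.subtype) :=
  fun _ hW => map_subtype_eq_bot_iff.1 (hX _ (disjoint_map_subtype hW))

theorem exists_maximal_disjoint {X Y₀ : Submodule A M} (h : Disjoint X Y₀) :
    ∃ Y, Y₀ ≤ Y ∧ Maximal (Disjoint X) Y :=
  zorn_le_nonempty₀ {Y | Disjoint X Y} (fun c hc hchain _ _ =>
    ⟨sSup c, hchain.directedOn.disjoint_sSup_right.2 fun _ hb => hc hb,
      fun _ => le_sSup⟩) Y₀ h

/-- A maximal submodule above the socle works: a submodule missing it is simple, hence inside it. -/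
theorem exists_isCoatom_isEssential_of_not_isSemisimpleModule [Module.Finite A M]
    (h : ¬ IsSemisimpleModule A M) : ∃ K : Submodule A M, IsCoatom K ∧ IsEssential K := by
  have hsocle : socle A M ≠ ⊤ := fun htop => h (IsSemisimpleModule.of_sSup_simples_eq_top htop)
  obtain ⟨K, hK, hsocleK⟩ := (eq_top_or_exists_le_coatom _).resolve_left hsocle
  refine ⟨K, hK, fun W hW => ?_⟩
  by_contra hW0
  have hWK : ¬ W ≤ K := fun hle => hW0 (hW.eq_bot_of_ge hle)
  have hcompl : IsCompl K W := ⟨hW, codisjoint_iff.2 (hK.2 _ (left_lt_sup.2 hWK))⟩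
  have hWs : IsSimpleModule A W :=
    isSimpleModule_iff_isAtom.2 (hcompl.symm.isAtom_iff_isCoatom.2 hK)
  exact hWK ((le_sSup hWs : W ≤ socle A M).trans hsocleK)

end Essential

section Injective

variable {A : Type u} [Ring A] {M N : Type v} [AddCommGroup M] [Module A M]
  [AddCommGroup N] [Module A N]

theorem injective_of_retract [Module.Injective A M] (i : N →ₗ[A] M) (r : M →ₗ[A] N)
    (h : ∀ x, r (i x) = x) : Module.Injective A N := by
  refine ⟨fun X Y _ _ _ _ f hf g => ?_⟩
  obtain ⟨k, hk⟩ := Module.Injective.out f hf (i ∘ₗ g)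
  exact ⟨r ∘ₗ k, fun x => by simp [hk, h]⟩

theorem injective_of_linearEquiv [Module.Injective A M] (e : M ≃ₗ[A] N) :
    Module.Injective A N :=
  injective_of_retract e.symm.toLinearMap e.toLinearMap e.apply_symm_apply

theorem injective_of_isDirectSummand [Module.Injective A M] {D : Submodule A M}
    (h : IsDirectSummand D) : Module.Injective A D := by
  obtain ⟨r, hr⟩ := exists_retraction_of_isDirectSummand h
  exact injective_of_retract D.subtype r hr

theorem isDirectSummand_of_injective (D : Submodule A M) [Module.Injective A D] :
    IsDirectSummand D := by
  obtain ⟨r, hr⟩ := Module.Injective.out D.subtype D.injective_subtype LinearMap.id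
  exact isDirectSummand_of_retraction r hr

theorem exists_injective_submodule_of_le_range {i : M →ₗ[A] N} (hi : Function.Injective i)
    {D : Submodule A N} (hle : D ≤ LinearMap.range i) (hD : D ≠ ⊥) [Module.Injective A D] :
    ∃ D' : Submodule A M, D' ≠ ⊥ ∧ Module.Injective A D' := by
  have hmap : (D.comap i).map i = D := by rw [Submodule.map_comap_eq, inf_eq_right.2 hle]
  refine ⟨D.comap i, fun h0 => hD (by rw [← hmap, h0, Submodule.map_bot]), ?_⟩
  exact injective_of_linearEquiv
    ((Submodule.equivMapOfInjective i hi _).trans (LinearEquiv.ofEq _ _ hmap)).symm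

theorem exists_injective_embedding (A M : Type u) [Ring A] [AddCommGroup M] [Module A M] :
    ∃ (E : Type u) (_ : AddCommGroup E) (_ : Module A E) (i : M →ₗ[A] E),
      Module.Injective A E ∧ Function.Injective i := by
  let J := CategoryTheory.Injective.under (ModuleCat.of A M)
  let f : ModuleCat.of A M ⟶ J := CategoryTheory.Injective.ι _
  exact ⟨J, inferInstance, inferInstance, f.hom,
    (Module.injective_iff_injective_object A J).2 (CategoryTheory.Injective.injective_under _),
    (ModuleCat.mono_iff_injective f).1 inferInstance⟩

theorem exists_extension_vanishing [Module.Injective A N] {X Y : Submodule A M}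
    (h : Disjoint X Y) (g : X →ₗ[A] N) :
    ∃ k : M →ₗ[A] N, (∀ x : X, k x = g x) ∧ ∀ y ∈ Y, k y = 0 := by
  have hinj : Function.Injective (Y.mkQ ∘ₗ X.subtype) := by
    rw [← LinearMap.ker_eq_bot, LinearMap.ker_comp, Submodule.ker_mkQ]
    exact Submodule.disjoint_iff_comap_eq_bot.1 h
  obtain ⟨k, hk⟩ := Module.Injective.out _ hinj g
  exact ⟨k ∘ₗ Y.mkQ, hk, fun y hy => by simp [(Submodule.Quotient.mk_eq_zero Y).2 hy]⟩

/-- Among the submodules disjoint from a maximal complement `Y` of `X`, a maximal `Z ≥ X` is the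
image of any map `φ` that is the identity on `Z` and zero on `Y`: the range of `φ` still misses
`Y`. -/
theorem isDirectSummand_of_maximal_disjoint [Module.Injective A M] {X Y Z : Submodule A M}
    (hY : Maximal (Disjoint X) Y) (hXZ : X ≤ Z) (hZ : Maximal (Disjoint Y) Z) :
    IsDirectSummand Z := by
  obtain ⟨φ, hφZ, hφY⟩ := exists_extension_vanishing hZ.prop.symm Z.subtype
  have hφZ' : ∀ z ∈ Z, φ z = z := fun z hz => hφZ ⟨z, hz⟩
  have hcomap : Y.comap φ ≤ Y := by
    refine hY.2 (Submodule.disjoint_def.2 fun x hx hx' => ?_) fun y hy => by simp [hφY y hy]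
    exact Submodule.disjoint_def.1 hY.prop x hx (by simpa [hφZ' x (hXZ hx)] using hx')
  have hrange : LinearMap.range φ ≤ Z := by
    refine hZ.2 (Submodule.disjoint_def.2 ?_) fun z hz => ⟨z, hφZ' z hz⟩
    rintro _ hx ⟨p, rfl⟩
    exact hφY p (hcomap hx)
  exact isDirectSummand_iff_exists_isProj.2 ⟨φ, fun x => hrange ⟨x, rfl⟩, hφZ'⟩

theorem exists_isDirectSummand_isEssential_comap [Module.Injective A M] (X : Submodule A M) :
    ∃ Z, X ≤ Z ∧ IsDirectSummand Z ∧ IsEssential (X.comap Z.subtype) := by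
  obtain ⟨Y, -, hY⟩ := exists_maximal_disjoint (disjoint_bot_right (a := X))
  obtain ⟨Z, hXZ, hZ⟩ := exists_maximal_disjoint hY.prop.symm
  refine ⟨Z, hXZ, isDirectSummand_of_maximal_disjoint hY hXZ hZ, fun W hW => ?_⟩
  have hWZ : W.map Z.subtype ≤ Z := Submodule.map_subtype_le Z W
  have hXYW : Disjoint X (W.map Z.subtype ⊔ Y) :=
    (disjoint_map_subtype hW).disjoint_sup_right_of_disjoint_sup_left
      (hZ.prop.symm.mono_left (sup_le hXZ hWZ))
  have hWY : W.map Z.subtype ≤ Y := le_sup_left.trans (hY.2 hXYW le_sup_right)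
  exact map_subtype_eq_bot_iff.1 (eq_bot_iff.2 (hZ.prop.le_bot.trans' (le_inf hWY hWZ)))

/-- The map from an injective envelope `H` of `A w` in `Q` to `D` is injective, since `H`
is an essential extension of `A w`, on which it is the identity. -/
theorem exists_injective_le_of_mem_isDirectSummand {D Q : Submodule A M} (hD : IsDirectSummand D)
    [Module.Injective A Q] {w : M} (hwD : w ∈ D) (hwQ : w ∈ Q) (hw : w ≠ 0) :
    ∃ D' ≤ D, D' ≠ ⊥ ∧ Module.Injective A D' := by
  obtain ⟨r, hr⟩ := exists_retraction_of_isDirectSummand hD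
  obtain ⟨H, hwH, hH, hess⟩ :=
    exists_isDirectSummand_isEssential_comap (A ∙ (⟨w, hwQ⟩ : Q))
  have hwH' : (⟨w, hwQ⟩ : Q) ∈ H := hwH (Submodule.mem_span_singleton_self _)
  have : Module.Injective A H := injective_of_isDirectSummand hH
  let k : H →ₗ[A] M := D.subtype ∘ₗ r ∘ₗ Q.subtype ∘ₗ H.subtype
  have hk : Function.Injective k := by
    refine LinearMap.ker_eq_bot.1 (hess _ (Submodule.disjoint_def.2 fun x hx hkx => ?_))
    have hxD : ((x : Q) : M) ∈ D := by
      obtain ⟨a, ha⟩ := Submodule.mem_span_singleton.1 hx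
      have haw : a • w = (x : Q) := congrArg Subtype.val ha
      exact haw ▸ D.smul_mem a hwD
    have hkx' : k x = x := congrArg Subtype.val (hr ⟨x, hxD⟩)
    exact Subtype.ext (Subtype.ext (hkx'.symm.trans hkx))
  refine ⟨LinearMap.range k, ?_, fun h0 => ?_,
    injective_of_linearEquiv (LinearEquiv.ofInjective k hk)⟩
  · rintro _ ⟨x, rfl⟩
    exact (r _).2
  · have hkw : k ⟨⟨w, hwQ⟩, hwH'⟩ = w := congrArg Subtype.val (hr ⟨w, hwD⟩)
    exact hw (hkw.symm.trans (by simp [LinearMap.range_eq_bot.1 h0]))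

end Injective

section FiniteSemisimpleOrInjective

variable {A : Type u} [Ring A] {M E : Type v} [AddCommGroup M] [Module A M]
  [AddCommGroup E] [Module A E]

/-- Every finitely generated module is semisimple or contains a nonzero injective submodule: the
consequence shared by the `I₀` condition and by almost projectivity of the simple modules. -/
def FiniteSemisimpleOrInjective (A : Type u) [Ring A] : Prop :=
  ∀ (M : Type u) [AddCommGroup M] [Module A M] [Module.Finite A M],
    IsSemisimpleModule A M ∨ ∃ D : Submodule A M, D ≠ ⊥ ∧ Module.Injective A D

theorem not_isSmallSubmodule_range_prod_mkQ (i : M →ₗ[A] E) {K : Submodule A M} (hK : K ≠ ⊤) :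
    ¬ IsSmallSubmodule (LinearMap.range (i.prod K.mkQ)) := by
  intro hsmall
  have hsup : LinearMap.range (i.prod K.mkQ) ⊔ Submodule.fst A E (M ⧸ K) = ⊤ := by
    refine eq_top_iff.2 fun ⟨e, y⟩ _ => ?_
    obtain ⟨m, rfl⟩ := K.mkQ_surjective y
    exact Submodule.mem_sup.2 ⟨_, ⟨m, rfl⟩, (e - i m, 0), rfl, by simp⟩
  refine hK (K.ker_mkQ.symm.trans (LinearMap.ker_eq_top.2 (LinearMap.ext fun m => ?_)))
  exact (hsmall _ hsup ▸ Submodule.mem_top : ((0 : E), K.mkQ m) ∈ Submodule.fst A E (M ⧸ K))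

/-- `K` is carried into the injective summand `E` of `E × (M ⧸ K)`, so a summand of the product
inside the image of `M` meets `E`. -/
theorem exists_injective_of_isI0Module_prod [Module.Injective A E] {i : M →ₗ[A] E}
    (hi : Function.Injective i) {K : Submodule A M} (hK : K ≠ ⊤) (hess : IsEssential K)
    (h : IsI0Module A (E × (M ⧸ K))) : ∃ D : Submodule A M, D ≠ ⊥ ∧ Module.Injective A D := by
  have hinj : Function.Injective (i.prod K.mkQ) := fun x y hxy => hi (congrArg Prod.fst hxy)
  obtain ⟨D, hDle, hD0, hD⟩ := h _ (not_isSmallSubmodule_range_prod_mkQ i hK)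
  have hKfst : K ≤ (Submodule.fst A E (M ⧸ K)).comap (i.prod K.mkQ) :=
    fun m hm => (Submodule.Quotient.mk_eq_zero K).2 hm
  have hmeet : ¬ Disjoint (Submodule.fst A E (M ⧸ K)) D := by
    intro hdisj
    have hcomap : D.comap (i.prod K.mkQ) = ⊥ := by
      refine hess _ (Disjoint.mono_left hKfst (disjoint_iff.2 ?_))
      rw [← Submodule.comap_inf, hdisj.eq_bot, Submodule.comap_bot, LinearMap.ker_eq_bot.2 hinj]
    refine hD0 (eq_bot_iff.2 fun d hd => ?_)
    obtain ⟨m, rfl⟩ := hDle hd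
    have hm : m = 0 := (Submodule.mem_bot A).1 (hcomap ▸ hd)
    simp [hm]
  obtain ⟨w, hwE, hwD, hw⟩ : ∃ w ∈ Submodule.fst A E (M ⧸ K), w ∈ D ∧ w ≠ 0 := by
    simpa [Submodule.disjoint_def] using hmeet
  have : Module.Injective A (Submodule.fst A E (M ⧸ K)) :=
    injective_of_linearEquiv (Submodule.fstEquiv A E (M ⧸ K)).symm
  obtain ⟨D', hD'D, hD'0, _⟩ := exists_injective_le_of_mem_isDirectSummand hD hwD hwE hw
  exact exists_injective_submodule_of_le_range hinj (hD'D.trans hDle) hD'0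

theorem mem_range_of_mkQ_eq_mapQ {i : M →ₗ[A] E} {K : Submodule A M} {e : E} {x : M ⧸ K}
    (h : (K.map i).mkQ e = K.mapQ (K.map i) i (Submodule.le_comap_map i K) x) :
    ∃ m, i m = e ∧ K.mkQ m = x := by
  obtain ⟨m, rfl⟩ := K.mkQ_surjective x
  obtain ⟨k, hk, hke⟩ : e - i m ∈ K.map i := (Submodule.Quotient.eq _).1 h
  refine ⟨k + m, by rw [map_add, hke, sub_add_cancel], ?_⟩
  rw [map_add, Submodule.mkQ_apply, (Submodule.Quotient.mk_eq_zero K).2 hk, zero_add]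

/-- Apply almost projectivity to the map `M ⧸ K → E ⧸ i(K)`: a lift of it to `E` would split
`K ≤ M`, while the other alternative exhibits a summand of `E` inside `i(M)`. -/
theorem exists_injective_of_isAlmostProjectiveTo [Module.Injective A E] {i : M →ₗ[A] E}
    (hi : Function.Injective i) {K : Submodule A M} (hK : K ≠ ⊤) (hess : IsEssential K)
    (h : IsAlmostProjectiveTo A (M ⧸ K) E) :
    ∃ D : Submodule A M, D ≠ ⊥ ∧ Module.Injective A D := by
  rcases h (K.map i) (K.mapQ _ i (Submodule.le_comap_map i K)) with
    ⟨g, hg⟩ | ⟨D, hD0, hD, g, hg⟩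
  · have hlift : ∀ x, ∃ m, i m = g x ∧ K.mkQ m = x := fun x =>
      mem_range_of_mkQ_eq_mapQ (LinearMap.congr_fun hg x).symm
    have hbot : (LinearMap.range g).comap i = ⊥ := by
      refine hess _ (Submodule.disjoint_def.2 fun m hmK ⟨x, hx⟩ => hi ?_)
      obtain ⟨m', hm', rfl⟩ := hlift x
      obtain rfl : m' = m := hi (hm'.trans hx)
      rw [← hx, Submodule.mkQ_apply, (Submodule.Quotient.mk_eq_zero K).2 hmK, map_zero, map_zero]
    refine absurd (K.ker_mkQ.symm.trans (LinearMap.ker_eq_top.2 (LinearMap.ext fun m => ?_))) hK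
    obtain ⟨m', hm', hm⟩ := hlift (K.mkQ m)
    have hm'0 : m' ∈ (⊥ : Submodule A M) := hbot ▸ ⟨K.mkQ m, hm'.symm⟩
    rw [← hm, (Submodule.mem_bot A).1 hm'0, map_zero, LinearMap.zero_apply]
  · have hle : D ≤ LinearMap.range i := fun e he =>
      have ⟨m, hm, _⟩ := mem_range_of_mkQ_eq_mapQ (LinearMap.congr_fun hg ⟨e, he⟩)
      ⟨m, hm⟩
    have : Module.Injective A D := injective_of_isDirectSummand hD
    exact exists_injective_submodule_of_le_range hi hle hD0

theorem finiteSemisimpleOrInjective_of_isI0Module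
    (h : ∀ (M : Type u) [AddCommGroup M] [Module A M], IsI0Module A M) :
    FiniteSemisimpleOrInjective A := by
  refine fun M _ _ _ => or_iff_not_imp_left.2 fun hss => ?_
  obtain ⟨K, hK, hess⟩ := exists_isCoatom_isEssential_of_not_isSemisimpleModule hss
  obtain ⟨E, _, _, i, _, hi⟩ := exists_injective_embedding A M
  exact exists_injective_of_isI0Module_prod hi hK.1 hess (h _)

theorem finiteSemisimpleOrInjective_of_isAlmostProjective
    (h : ∀ (S : Type u) [AddCommGroup S] [Module A S], IsSimpleModule A S →
      IsAlmostProjective A S) : FiniteSemisimpleOrInjective A := by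
  refine fun M _ _ _ => or_iff_not_imp_left.2 fun hss => ?_
  obtain ⟨K, hK, hess⟩ := exists_isCoatom_isEssential_of_not_isSemisimpleModule hss
  obtain ⟨E, _, _, i, _, hi⟩ := exists_injective_embedding A M
  exact exists_injective_of_isAlmostProjectiveTo hi hK.1 hess
    (h (M ⧸ K) (isSimpleModule_iff_isCoatom.2 hK) E)

end FiniteSemisimpleOrInjective
section RegularModules

variable {A : Type u} [Ring A] {P G : Type v} [AddCommGroup P] [Module A P]
  [AddCommGroup G] [Module A G]

/-- A (Zelmanowitz) regular module: its finitely generated submodules are direct summands. -/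
def IsRegularModule (A : Type u) [Ring A] (P : Type v) [AddCommGroup P] [Module A P] : Prop :=
  ∀ N : Submodule A P, N.FG → IsDirectSummand N

theorem isRegularModule_of_isDirectSummand_span_singleton
    (h : ∀ x : P, IsDirectSummand (A ∙ x)) : IsRegularModule A P := by
  classical
  rintro _ ⟨s, rfl⟩
  induction s using Finset.induction_on with
  | empty => exact ⟨⊤, by simpa using isCompl_bot_top⟩
  | insert x s _ ih =>
    obtain ⟨p, hp⟩ := isDirectSummand_iff_exists_isProj.1 ih
    obtain ⟨q, hq⟩ := isDirectSummand_iff_exists_isProj.1 (h (x - p x))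
    rw [Finset.coe_insert, Submodule.span_insert]
    have hx : x - p x ∈ (A ∙ x) ⊔ Submodule.span A s :=
      Submodule.sub_mem _ (Submodule.mem_sup_left (Submodule.mem_span_singleton_self x))
        (Submodule.mem_sup_right (hp.map_mem x))
    refine isDirectSummand_iff_exists_isProj.2
      ⟨p + q ∘ₗ (LinearMap.id - p), fun y => ?_, fun y hy => ?_⟩
    · exact Submodule.add_mem _ (Submodule.mem_sup_right (hp.map_mem y))
        ((Submodule.span_singleton_le_iff_mem _ _).2 hx (hq.map_mem _))
    · obtain ⟨_, hax, z, hz, rfl⟩ := Submodule.mem_sup.1 hy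
      obtain ⟨a, rfl⟩ := Submodule.mem_span_singleton.1 hax
      have hdiff : a • x + z - p (a • x + z) = a • (x - p x) := by
        rw [map_add, hp.map_id z hz, map_smul, add_sub_add_right_eq_sub, smul_sub]
      have hq' := hq.map_id _ (Submodule.smul_mem _ a (Submodule.mem_span_singleton_self (x - p x)))
      simp only [LinearMap.add_apply, LinearMap.comp_apply, LinearMap.sub_apply,
        LinearMap.id_apply, hdiff, hq']
      rw [← hdiff, add_sub_cancel]

theorem isRegularModule_self {A : Type u} [Ring A] (hA : IsVonNeumannRegularRing A) :
    IsRegularModule A A := by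
  refine isRegularModule_of_isDirectSummand_span_singleton fun a => ?_
  obtain ⟨b, hb⟩ := hA a
  refine isDirectSummand_iff_exists_isProj.2
    ⟨LinearMap.toSpanSingleton A A (b * a), fun x => ?_, fun x hx => ?_⟩
  · exact Submodule.mem_span_singleton.2 ⟨x * b, by simp [mul_assoc]⟩
  · obtain ⟨c, rfl⟩ := Submodule.mem_span_singleton.1 hx
    simp [← mul_assoc, mul_assoc c, hb]

theorem IsRegularModule.submodule (hP : IsRegularModule A P) (N : Submodule A P) :
    IsRegularModule A N := by
  intro X hX
  obtain ⟨p, hp⟩ := isDirectSummand_iff_exists_isProj.1 (hP _ (hX.map N.subtype))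
  have hpN : ∀ x, p x ∈ N := fun x => Submodule.map_subtype_le N X (hp.map_mem x)
  refine isDirectSummand_iff_exists_isProj.2
    ⟨(p.codRestrict N hpN) ∘ₗ N.subtype, fun x => ?_, fun x hx => ?_⟩
  · obtain ⟨z, hz, hzx⟩ := hp.map_mem x
    exact (Subtype.ext hzx : z = p.codRestrict N hpN x) ▸ hz
  · exact Subtype.ext (hp.map_id x ⟨x, hx, rfl⟩)

theorem exists_fg_map_eq_of_surjective {f : P →ₗ[A] G} (hf : Function.Surjective f)
    {N : Submodule A G} (hN : N.FG) : ∃ N' : Submodule A P, N'.FG ∧ N'.map f = N := by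
  obtain ⟨s, rfl⟩ := hN
  choose r hr using hf
  refine ⟨Submodule.span A (r '' s), Submodule.fg_span (s.finite_toSet.image r), ?_⟩
  rw [Submodule.map_span, Set.image_image]
  simp [hr]

theorem IsRegularModule.quotient (hP : IsRegularModule A P) {X : Submodule A P}
    (hX : ∀ f : P →ₗ[A] P, X ≤ X.comap f) : IsRegularModule A (P ⧸ X) := by
  intro N hN
  obtain ⟨N', hN', rfl⟩ := exists_fg_map_eq_of_surjective X.mkQ_surjective hN
  obtain ⟨p, hp⟩ := isDirectSummand_iff_exists_isProj.1 (hP N' hN')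
  refine isDirectSummand_iff_exists_isProj.2 ⟨X.mapQ X p (hX p), fun x => ?_, ?_⟩
  · obtain ⟨y, rfl⟩ := X.mkQ_surjective x
    exact ⟨p y, hp.map_mem y, rfl⟩
  · rintro _ ⟨y, hy, rfl⟩
    exact congrArg X.mkQ (hp.map_id y hy)

theorem IsRegularModule.eq_top_of_fg_of_isEssential (hP : IsRegularModule A P)
    {X : Submodule A P} (hX : X.FG) (hess : IsEssential X) : X = ⊤ := by
  obtain ⟨C, hC⟩ := hP X hX
  simpa [hess C hC.disjoint] using hC.sup_eq_top

end RegularModules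

section QuasiProjective

variable {A : Type u} [Ring A] {P : Type v} [AddCommGroup P] [Module A P]

/-- `P` is quasi-projective: maps from `P` to a homomorphic image of `P` lift to endomorphisms
of `P`. -/
def IsQuasiProjective (A : Type u) [Ring A] (P : Type v) [AddCommGroup P] [Module A P] : Prop :=
  ∀ (L : Type v) [AddCommGroup L] [Module A L] (g f : P →ₗ[A] L), Function.Surjective g →
    ∃ h : P →ₗ[A] P, g ∘ₗ h = f

theorem isQuasiProjective_of_projective [Module.Projective A P] : IsQuasiProjective A P :=
  fun _ _ _ g f hg => Module.projective_lifting_property g f hg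

theorem IsQuasiProjective.of_isDirectSummand (hP : IsQuasiProjective A P) {N : Submodule A P}
    (hN : IsDirectSummand N) : IsQuasiProjective A N := by
  intro L _ _ g f hg
  obtain ⟨r, hr⟩ := exists_retraction_of_isDirectSummand hN
  obtain ⟨h, hh⟩ := hP L (g ∘ₗ r) (f ∘ₗ r) (hg.comp fun x => ⟨x, hr x⟩)
  refine ⟨r ∘ₗ h ∘ₗ N.subtype, LinearMap.ext fun x => ?_⟩
  simpa [hr] using LinearMap.congr_fun hh x

theorem IsQuasiProjective.quotient (hP : IsQuasiProjective A P) {X : Submodule A P}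
    (hX : ∀ f : P →ₗ[A] P, X ≤ X.comap f) : IsQuasiProjective A (P ⧸ X) := by
  intro L _ _ g f hg
  obtain ⟨h, hh⟩ := hP L (g ∘ₗ X.mkQ) (f ∘ₗ X.mkQ) (hg.comp X.mkQ_surjective)
  exact ⟨X.mapQ X h (hX h), Submodule.linearMap_qext X hh⟩

variable {X Y : Submodule A P}

/-- The restriction of `h` to `X` splits onto its image, with a splitting `s` that is defined on
all of `P`. -/
theorem IsRegularModule.exists_section (hP : IsRegularModule A P) (hQ : IsQuasiProjective A P)
    (hX : X.FG) (h : P →ₗ[A] P) :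
    ∃ s : P →ₗ[A] P, ∀ x ∈ X, s (h x) ∈ X ∧ h (s (h x)) = h x := by
  obtain ⟨π, hπ⟩ := exists_retraction_of_isDirectSummand (hP X hX)
  obtain ⟨r, hr⟩ := exists_retraction_of_isDirectSummand (hP (X.map h) (hX.map h))
  obtain ⟨t, ht⟩ := hQ (X.map h) (h.submoduleMap X ∘ₗ π) r
    ((h.submoduleMap_surjective X).comp fun x => ⟨x, hπ x⟩)
  refine ⟨X.subtype ∘ₗ π ∘ₗ t, fun x hx => ⟨(π _).2, ?_⟩⟩
  have hhx : h.submoduleMap X (π (t (h x))) = ⟨h x, ⟨x, hx, rfl⟩⟩ :=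
    (LinearMap.congr_fun ht (h x)).trans (hr ⟨h x, ⟨x, hx, rfl⟩⟩)
  exact congrArg Subtype.val hhx

theorem IsRegularModule.fg_inf_ker (hP : IsRegularModule A P) (hQ : IsQuasiProjective A P)
    (hX : X.FG) (h : P →ₗ[A] P) : (X ⊓ LinearMap.ker h).FG := by
  obtain ⟨s, hs⟩ := hP.exists_section hQ hX h
  suffices X ⊓ LinearMap.ker h = X.map (LinearMap.id - s ∘ₗ h) from this ▸ hX.map _
  refine le_antisymm (fun x ⟨hx, hxh⟩ => ⟨x, hx, by simp [LinearMap.mem_ker.1 hxh]⟩) ?_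
  rintro _ ⟨x, hx, rfl⟩
  exact ⟨X.sub_mem hx (hs x hx).1, by simp [(hs x hx).2]⟩

theorem IsRegularModule.fg_inf (hP : IsRegularModule A P) (hQ : IsQuasiProjective A P)
    (hX : X.FG) (hY : Y.FG) : (X ⊓ Y).FG := by
  obtain ⟨q, hq⟩ := isDirectSummand_iff_exists_isProj.1 (hP Y hY)
  have hker : LinearMap.ker (LinearMap.id - q) = Y := by
    ext x
    rw [LinearMap.mem_ker, LinearMap.sub_apply, LinearMap.id_apply, sub_eq_zero, eq_comm,
      hq.mem_iff_map_id]
  exact hker ▸ hP.fg_inf_ker hQ hX _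

/-- Regular quasi-projective modules are nonsingular. -/
theorem IsRegularModule.eq_zero_of_isEssential_ker (hP : IsRegularModule A P)
    (hQ : IsQuasiProjective A P) {h : P →ₗ[A] P} (hh : IsEssential (LinearMap.ker h)) :
    h = 0 := by
  ext p
  obtain ⟨s, hs⟩ := hP.exists_section hQ (Submodule.fg_span_singleton p) h
  have hp : h (s (h p)) = h p := (hs p (Submodule.mem_span_singleton_self p)).2
  have hdisj : Disjoint (LinearMap.ker h) (A ∙ s (h p)) := by
    refine Submodule.disjoint_def.2 fun x hx hx' => ?_
    obtain ⟨a, rfl⟩ := Submodule.mem_span_singleton.1 hx'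
    have ha : a • h p = 0 := by simpa [hp] using hx
    rw [← map_smul, ha, map_zero]
  have hsp : s (h p) = 0 := Submodule.span_singleton_eq_bot.1 (hh _ hdisj)
  rw [← hp, hsp, map_zero, LinearMap.zero_apply]

theorem IsRegularModule.eq_of_eqOn_isEssential (hP : IsRegularModule A P)
    (hQ : IsQuasiProjective A P) (hX : IsEssential X) {f g : P →ₗ[A] P} (h : Set.EqOn f g X) :
    f = g :=
  sub_eq_zero.1 <| hP.eq_zero_of_isEssential_ker hQ <|
    hX.mono fun x hx => by simp [h hx]

end QuasiProjective

section CountablyGenerated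

variable {A : Type u} [Ring A] {P : Type v} [AddCommGroup P] [Module A P] {I N : Submodule A P}

/-- `I` is generated by a countable set. -/
def IsCountablyGenerated (I : Submodule A P) : Prop :=
  ∃ s : Set P, s.Countable ∧ Submodule.span A s = I

theorem isCountablyGenerated_iSup {F : ℕ → Submodule A P} (hF : ∀ n, (F n).FG) :
    IsCountablyGenerated (⨆ n, F n) := by
  choose s hs using hF
  refine ⟨⋃ n, (s n : Set P), Set.countable_iUnion fun n => (s n).countable_toSet, ?_⟩
  simp only [Submodule.span_iUnion, hs]

theorem IsCountablyGenerated.exists_monotone (hI : IsCountablyGenerated I) :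
    ∃ T : ℕ → Submodule A P, Monotone T ∧ T 0 = ⊥ ∧ (∀ n, (T n).FG) ∧ ⨆ n, T n = I := by
  obtain ⟨s, hs, rfl⟩ := hI
  obtain ⟨f, hf⟩ := (hs.insert 0).exists_eq_range (Set.insert_nonempty 0 s)
  refine ⟨fun n => Submodule.span A (f '' Set.Iio n),
    fun m n hmn => Submodule.span_mono (Set.image_mono (Set.Iio_subset_Iio hmn)), by simp,
    fun n => Submodule.fg_span ((Set.finite_Iio n).image f), ?_⟩
  rw [← Submodule.span_insert_zero, hf, ← Submodule.span_iUnion, ← Set.image_iUnion,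
    Set.iUnion_Iio, Set.image_univ]

theorem iSup_comap_subtype_of_monotone {T : ℕ → Submodule A P} (hT : Monotone T)
    (N : Submodule A P) :
    ⨆ n, (T n).comap N.subtype = (⨆ n, T n).comap N.subtype := by
  ext x
  rw [Submodule.mem_iSup_of_directed _
      (directed_of_isDirected_le fun m n h => Submodule.comap_mono (hT h)),
    Submodule.mem_comap, Submodule.mem_iSup_of_directed _ (directed_of_isDirected_le hT)]
  rfl

theorem IsRegularModule.isCountablyGenerated_comap_subtype (hP : IsRegularModule A P)
    (hQ : IsQuasiProjective A P) (hI : IsCountablyGenerated I) (hN : N.FG) :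
    IsCountablyGenerated (I.comap N.subtype) := by
  obtain ⟨T, hT, -, hfg, rfl⟩ := hI.exists_monotone
  rw [← iSup_comap_subtype_of_monotone hT]
  refine isCountablyGenerated_iSup fun n =>
    Submodule.fg_of_fg_map_injective N.subtype N.injective_subtype ?_
  rw [Submodule.map_comap_subtype]
  exact hP.fg_inf hQ hN (hfg n)

theorem exists_isCountablyGenerated_not_fg_of_not_isNoetherian (h : ¬ IsNoetherian A P) :
    ∃ I : Submodule A P, IsCountablyGenerated I ∧ ¬ I.FG := by
  have hwf : ¬ WellFoundedGT (Submodule A P) := fun hw => h (isNoetherian_iff'.2 hw)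
  rw [WellFoundedGT, isWellFounded_iff, RelEmbedding.wellFounded_iff_isEmpty,
    not_isEmpty_iff] at hwf
  obtain ⟨f⟩ := hwf
  have hf : StrictMono f := fun m n hmn => f.map_rel_iff.2 hmn
  choose x hx hx' using fun n => SetLike.exists_of_lt (hf (Nat.lt_succ_self n))
  refine ⟨Submodule.span A (Set.range x), ⟨_, Set.countable_range x, rfl⟩, fun hfg => ?_⟩
  obtain ⟨n, hn⟩ := hfg.stabilizes_of_iSup_eq
    ⟨fun n => Submodule.span A (Set.range x) ⊓ f n, fun m n hmn =>
      inf_le_inf_left _ (hf.monotone hmn)⟩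
    (le_antisymm (iSup_le fun n => inf_le_left) (Submodule.span_le.2 (by
      rintro _ ⟨k, rfl⟩
      exact Submodule.mem_iSup_of_mem (k + 1) ⟨Submodule.subset_span ⟨k, rfl⟩, hx k⟩)))
  have hxn : x n ∈ Submodule.span A (Set.range x) := Submodule.subset_span ⟨n, rfl⟩
  rw [hn] at hxn
  exact hx' n hxn.2

theorem IsRegularModule.exists_fg_relative_compl (hP : IsRegularModule A P)
    {X Y : Submodule A P} (hX : X.FG) (hY : Y.FG) (h : X ≤ Y) :
    ∃ C : Submodule A P, C.FG ∧ Disjoint X C ∧ X ⊔ C = Y := by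
  obtain ⟨p, hp⟩ := isDirectSummand_iff_exists_isProj.1 (hP X hX)
  refine ⟨Y.map (LinearMap.id - p), hY.map _, Submodule.disjoint_def.2 ?_, le_antisymm ?_ ?_⟩
  · rintro _ hx ⟨y, -, rfl⟩
    rw [← hp.map_id _ hx]
    simp [hp.map_id _ (hp.map_mem y)]
  · refine sup_le h ?_
    rintro _ ⟨y, hy, rfl⟩
    exact Y.sub_mem hy (h (hp.map_mem y))
  · intro y hy
    exact Submodule.mem_sup.2 ⟨p y, hp.map_mem y, y - p y, ⟨y, hy, rfl⟩,
      add_sub_cancel (p y) y⟩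

theorem iSupIndep_of_disjoint_monotone {T Q : ℕ → Submodule A P} (hT : Monotone T)
    (hQT : ∀ k, Q k ≤ T (k + 1)) (hd : ∀ k, Disjoint (T k) (Q k)) : iSupIndep Q := by
  refine iSupIndep_iff_supIndep.2 fun s => ?_
  induction s using Finset.induction_on_max with
  | empty => exact Finset.supIndep_empty Q
  | insert k s hk ih =>
    exact ih.insert ((hd k).symm.mono_right
      (Finset.sup_le fun j hj => (hQT j).trans (hT (hk j hj))))

theorem exists_ne_bot_of_iSupIndep_of_not_fg {Q : ℕ → Submodule A P} (hind : iSupIndep Q)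
    (hfg : ∀ k, (Q k).FG) (hsup : ¬ (⨆ k, Q k).FG) :
    ∃ Q' : ℕ → Submodule A P, iSupIndep Q' ∧ (∀ k, (Q' k).FG) ∧ (∀ k, Q' k ≠ ⊥) ∧
      ⨆ k, Q' k = ⨆ k, Q k := by
  classical
  have : Infinite {k | Q k ≠ ⊥} := by
    by_contra hfin
    rw [not_infinite_iff_finite] at hfin
    have : Finite {k // Q k ≠ ⊥} := hfin
    exact hsup (iSup_ne_bot_subtype Q ▸ Submodule.fg_iSup _ fun k => hfg k)
  let e : ℕ ≃o {k | Q k ≠ ⊥} := Nat.Subtype.orderIsoOfNat _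
  refine ⟨fun n => Q (e n), hind.comp (Subtype.val_injective.comp e.injective),
    fun k => hfg _, fun k => (e k).2, ?_⟩
  rw [← iSup_ne_bot_subtype Q]
  exact e.toEquiv.iSup_comp (g := fun k : {k // Q k ≠ ⊥} => Q k)

theorem IsRegularModule.exists_iSupIndep_of_isCountablyGenerated (hP : IsRegularModule A P)
    (hI : IsCountablyGenerated I) (hfg : ¬ I.FG) :
    ∃ Q : ℕ → Submodule A P, iSupIndep Q ∧ (∀ k, (Q k).FG) ∧ (∀ k, Q k ≠ ⊥) ∧
      ⨆ k, Q k = I := by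
  obtain ⟨T, hT, hT0, hTfg, rfl⟩ := hI.exists_monotone
  choose Q hQfg hd hQ using fun k =>
    hP.exists_fg_relative_compl (hTfg k) (hTfg (k + 1)) (hT k.le_succ)
  have hQT : ∀ k, Q k ≤ T (k + 1) := fun k => hQ k ▸ le_sup_right
  have hTQ : ∀ n, T n ≤ ⨆ k, Q k := fun n => by
    induction n with
    | zero => exact hT0 ▸ bot_le
    | succ n ih => exact hQ n ▸ sup_le ih (le_iSup Q n)
  have hsup : ⨆ k, Q k = ⨆ n, T n :=
    le_antisymm (iSup_le fun k => (hQT k).trans (le_iSup T _)) (iSup_le hTQ)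
  exact hsup ▸ exists_ne_bot_of_iSupIndep_of_not_fg
    (iSupIndep_of_disjoint_monotone hT hQT hd) hQfg (hsup ▸ hfg)

end CountablyGenerated

section OrthogonalIdempotents

variable {A : Type u} [Ring A] {M : Type v} [AddCommGroup M] [Module A M] {ι : Type*}
  {ψ : ι → Module.End A M}

theorem iSupIndep_range_of_orthogonalIdempotents (hψ : OrthogonalIdempotents ψ) :
    iSupIndep fun i => LinearMap.range (ψ i) := by
  refine fun i => (LinearMap.IsIdempotentElem.isCompl (hψ.idem i)).disjoint.mono_right
    (iSup₂_le fun j hj => ?_)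
  rintro _ ⟨x, rfl⟩
  exact LinearMap.congr_fun (hψ.ortho hj.symm) x

theorem disjoint_iSup_range_iInf_ker_of_orthogonalIdempotents (hψ : OrthogonalIdempotents ψ) :
    Disjoint (⨆ i, LinearMap.range (ψ i)) (⨅ i, LinearMap.ker (ψ i)) := by
  refine Submodule.disjoint_def.2 fun x hx hx' => ?_
  obtain ⟨s, hs⟩ := Submodule.mem_iSup_iff_exists_finset.1 hx
  have hrange : ⨆ i ∈ s, LinearMap.range (ψ i) ≤ LinearMap.range (∑ i ∈ s, ψ i) :=
    iSup₂_le fun i hi => by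
      have hi' : (∑ j ∈ s, ψ j) * ψ i = ψ i := by
        rw [Finset.sum_mul, Finset.sum_eq_single_of_mem i hi fun j _ hj => hψ.ortho hj,
          hψ.idem i]
      rw [← hi']
      exact LinearMap.range_comp_le_range _ _
  rw [← (LinearMap.IsIdempotentElem.mem_range_iff hψ.isIdempotentElem_sum).1 (hrange hs),
    LinearMap.sum_apply]
  exact Finset.sum_eq_zero fun i _ => (Submodule.mem_iInf _).1 hx' i

end OrthogonalIdempotents

section Osofsky

variable {A : Type u} [Ring A] {P : Type v} [AddCommGroup P] [Module A P] {ι J : Type*}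
  {Q : ι → Submodule A P} {C D : Set ι} {θ η : P →ₗ[A] P}

/-- `θ` acts on a family `Q` of submodules as the projection onto the members with index in `C`:
it is the identity on those and zero on the others. -/
structure IsBlockProjection (Q : ι → Submodule A P) (C : Set ι) (θ : P →ₗ[A] P) : Prop where
  eq_self : ∀ k ∈ C, ∀ q ∈ Q k, θ q = q
  eq_zero : ∀ k ∉ C, ∀ q ∈ Q k, θ q = 0

theorem exists_isBlockProjection [Module.Injective A P] (hQ : iSupIndep Q) (C : Set ι) :
    ∃ θ, IsBlockProjection Q C θ := by
  obtain ⟨θ, hθ, hθ'⟩ := exists_extension_vanishing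
    (hQ.disjoint_biSup_biSup (disjoint_compl_right (a := C))) (⨆ k ∈ C, Q k).subtype
  exact ⟨θ, fun k hk q hq => hθ ⟨q, le_biSup Q hk hq⟩, fun k hk q hq => hθ' q (le_biSup Q hk hq)⟩

theorem IsBlockProjection.comp (hθ : IsBlockProjection Q C θ) (hη : IsBlockProjection Q D η) :
    IsBlockProjection Q (C ∩ D) (θ ∘ₗ η) where
  eq_self k hk q hq := by simp [hη.eq_self k hk.2 q hq, hθ.eq_self k hk.1 q hq]
  eq_zero k hk q hq := by
    by_cases hD : k ∈ D
    · simp [hη.eq_self k hD q hq, hθ.eq_zero k (fun hC => hk ⟨hC, hD⟩) q hq]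
    · simp [hη.eq_zero k hD q hq]

theorem IsBlockProjection.iSup_le_comap (hθ : IsBlockProjection Q C θ) :
    ⨆ k, Q k ≤ (⨆ k, Q k).comap θ := by
  refine iSup_le fun k q hq => ?_
  by_cases hk : k ∈ C
  · simpa [hθ.eq_self k hk q hq] using le_iSup Q k hq
  · simp [hθ.eq_zero k hk q hq]

theorem exists_finite_range_le_biSup [Module.Finite A P] (h : LinearMap.range θ ≤ ⨆ k, Q k) :
    ∃ s : Set ι, s.Finite ∧ LinearMap.range θ ≤ ⨆ k ∈ s, Q k := by
  have hfg : (LinearMap.range θ).FG := Module.Finite.iff_fg.1 inferInstance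
  obtain ⟨s, hs⟩ := CompleteLattice.IsCompactElement.exists_finset_of_le_iSup
    (Submodule A P) ((Submodule.fg_iff_compact _).1 hfg) Q h
  exact ⟨s, s.finite_toSet, hs⟩

theorem IsBlockProjection.finite_of_range_le [Module.Finite A P] (hθ : IsBlockProjection Q C θ)
    (hQ : iSupIndep Q) (hne : ∀ k, Q k ≠ ⊥) (h : LinearMap.range θ ≤ ⨆ k, Q k) : C.Finite := by
  obtain ⟨s, hs, hle⟩ := exists_finite_range_le_biSup h
  refine hs.subset fun k hk => by_contra fun hks => hne k ?_
  exact (hQ.disjoint_biSup hks).eq_bot_of_le fun q hq => hle ⟨q, hθ.eq_self k hk q hq⟩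

section Essential

variable (hP : IsRegularModule A P) (hqp : IsQuasiProjective A P) (hess : IsEssential (⨆ k, Q k))
include hP hqp hess

theorem IsBlockProjection.unique (hθ : IsBlockProjection Q C θ) (hη : IsBlockProjection Q C η) :
    θ = η := by
  refine hP.eq_of_eqOn_isEssential hqp hess fun x hx => ?_
  suffices ⨆ k, Q k ≤ LinearMap.eqLocus θ η from this hx
  refine iSup_le fun k q hq => ?_
  by_cases hk : k ∈ C
  · exact (hθ.eq_self k hk q hq).trans (hη.eq_self k hk q hq).symm
  · exact (hθ.eq_zero k hk q hq).trans (hη.eq_zero k hk q hq).symm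

theorem IsBlockProjection.range_le_of_singleton {k : ι} (hk : (Q k).FG)
    (hθ : IsBlockProjection Q {k} θ) : LinearMap.range θ ≤ Q k := by
  obtain ⟨ρ, hρ⟩ := isDirectSummand_iff_exists_isProj.1 (hP _ hk)
  have hρθ : IsBlockProjection Q {k} (ρ ∘ₗ θ) := by
    refine ⟨?_, fun j hj q hq => by simp [hθ.eq_zero j hj q hq]⟩
    rintro _ rfl q hq
    simp [hθ.eq_self _ rfl q hq, hρ.map_id q hq]
  rw [hθ.unique hP hqp hess hρθ]
  rintro _ ⟨x, rfl⟩
  exact hρ.map_mem _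

variable {B : J → Set ι} {θ : J → P →ₗ[A] P} (hB : Pairwise (Function.onFun Disjoint B))
  (hθ : ∀ j, IsBlockProjection Q (B j) (θ j))
include hB

theorem orthogonalIdempotents_mapQ_isBlockProjection :
    OrthogonalIdempotents (R := Module.End A (P ⧸ ⨆ k, Q k)) fun j =>
      Submodule.mapQ _ _ (θ j) (hθ j).iSup_le_comap where
  idem j := by
    have hidem : θ j ∘ₗ θ j = θ j :=
      (((Set.inter_self (B j)) ▸ (hθ j).comp (hθ j) :
        IsBlockProjection Q (B j) _)).unique hP hqp hess (hθ j)
    refine Submodule.linearMap_qext _ (LinearMap.ext fun p => ?_)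
    exact congrArg (⨆ k, Q k).mkQ (LinearMap.congr_fun hidem p)
  ortho i j hij := by
    have hzero : θ i ∘ₗ θ j = 0 :=
      ((Set.disjoint_iff_inter_eq_empty.1 (hB hij)) ▸ (hθ i).comp (hθ j) :
        IsBlockProjection Q ∅ _).unique hP hqp hess ⟨fun _ h => h.elim, fun _ _ _ _ => rfl⟩
    refine Submodule.linearMap_qext _ (LinearMap.ext fun p => ?_)
    exact congrArg (⨆ k, Q k).mkQ (LinearMap.congr_fun hzero p)

include hθ

theorem not_isNoetherian_quotient_iSup [Module.Finite A P] [Infinite J] (hQ : iSupIndep Q)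
    (hne : ∀ k, Q k ≠ ⊥) (hBinf : ∀ j, (B j).Infinite) : ¬ IsNoetherian A (P ⧸ ⨆ k, Q k) := by
  intro hN
  have hfin := Submodule.finite_ne_bot_of_iSupIndep (iSupIndep_range_of_orthogonalIdempotents
    (orthogonalIdempotents_mapQ_isBlockProjection hP hqp hess hB hθ))
  refine Set.infinite_univ (hfin.subset fun j _ h0 => hBinf j ((hθ j).finite_of_range_le hQ hne ?_))
  rintro _ ⟨p, rfl⟩
  exact (Submodule.Quotient.mk_eq_zero _).1
    (LinearMap.congr_fun (LinearMap.range_eq_bot.1 h0) ((⨆ k, Q k).mkQ p))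

theorem exists_range_comp_le_and_not_range_comp_le [Module.Finite A P] [Module.Injective A P]
    [Infinite J] (hQ : iSupIndep Q) (hfg : ∀ k, (Q k).FG) (hne : ∀ k, Q k ≠ ⊥)
    (hBinf : ∀ j, (B j).Infinite) {x : P →ₗ[A] P}
    (hx : ∀ j, LinearMap.range ((x - LinearMap.id) ∘ₗ θ j) ≤ ⨆ k, Q k) :
    ∃ η : P →ₗ[A] P, (∀ j, LinearMap.range (θ j ∘ₗ η) ≤ ⨆ k, Q k) ∧
      ¬ LinearMap.range (x ∘ₗ η) ≤ ⨆ k, Q k := by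
  choose s hs hxs using fun j => exists_finite_range_le_biSup (hx j)
  choose k hkB hks using fun j => (hBinf j).exists_notMem_finite (hs j)
  have hkinj : Function.Injective k := fun i j hij => by_contra fun hne =>
    Set.disjoint_left.1 (hB hne) (hkB i) (hij ▸ hkB j)
  obtain ⟨η, hη⟩ := exists_isBlockProjection hQ (Set.range k)
  refine ⟨η, fun j => ?_, fun hxη => ?_⟩
  · have hinter : B j ∩ Set.range k = {k j} := by
      refine Set.eq_singleton_iff_unique_mem.2 ⟨⟨hkB j, j, rfl⟩, ?_⟩
      rintro _ ⟨hi, i, rfl⟩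
      by_contra hne
      exact Set.disjoint_left.1 (hB fun h => hne (congrArg k h)) (hkB i) hi
    exact (IsBlockProjection.range_le_of_singleton hP hqp hess (hfg (k j))
      (hinter ▸ (hθ j).comp hη)).trans (le_iSup Q _)
  · obtain ⟨t, ht, hxt⟩ := exists_finite_range_le_biSup hxη
    obtain ⟨_, ⟨j, rfl⟩, hjt⟩ := (Set.infinite_range_of_injective hkinj).exists_notMem_finite ht
    refine hne (k j) ((hQ.disjoint_biSup (y := t ∪ s j) (by simp [hjt, hks j])).eq_bot_of_le
      fun q hq => ?_)
    have hxq : x q ∈ ⨆ k ∈ t, Q k := hxt ⟨q, by simp [hη.eq_self _ ⟨j, rfl⟩ q hq]⟩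
    have hxq' : x q - q ∈ ⨆ k ∈ s j, Q k :=
      hxs j ⟨q, by simp [(hθ j).eq_self _ (hkB j) q hq]⟩
    rw [← sub_sub_cancel (x q) q, iSup_union]
    exact Submodule.sub_mem _ (Submodule.mem_sup_left hxq) (Submodule.mem_sup_right hxq')

/-- If `P ⧸ I` were injective, some endomorphism `f` of it would be the identity on the sum of
the images of the blocks and zero on the intersection of their kernels. The lemma above
contradicts this for a lift `x` of `f` to `P`. -/
theorem not_injective_quotient_iSup [Module.Finite A P] [Module.Injective A P]
    [Infinite J] (hQ : iSupIndep Q) (hfg : ∀ k, (Q k).FG) (hne : ∀ k, Q k ≠ ⊥)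
    (hBinf : ∀ j, (B j).Infinite) : ¬ Module.Injective A (P ⧸ ⨆ k, Q k) := by
  intro hinj
  obtain ⟨f, hf, hf'⟩ := exists_extension_vanishing
    (disjoint_iSup_range_iInf_ker_of_orthogonalIdempotents
      (orthogonalIdempotents_mapQ_isBlockProjection hP hqp hess hB hθ)) (Submodule.subtype _)
  obtain ⟨x, hx⟩ := hqp _ (⨆ k, Q k).mkQ (f ∘ₗ (⨆ k, Q k).mkQ) (Submodule.mkQ_surjective _)
  obtain ⟨η, hη, hxη⟩ := exists_range_comp_le_and_not_range_comp_le hP hqp hess hB hθ hQ hfg hne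
    hBinf (x := x) (by
      rintro j _ ⟨p, rfl⟩
      have hfθ := hf ⟨_, Submodule.mem_iSup_of_mem j ⟨(⨆ k, Q k).mkQ p, rfl⟩⟩
      exact (Submodule.Quotient.eq _).1 ((LinearMap.congr_fun hx (θ j p)).trans hfθ))
  refine hxη ?_
  rintro _ ⟨p, rfl⟩
  refine (Submodule.Quotient.mk_eq_zero _).1
    ((LinearMap.congr_fun hx (η p)).trans (hf' _ ((Submodule.mem_iInf _).2 fun j => ?_)))
  exact (Submodule.Quotient.mk_eq_zero _).2 (hη j ⟨p, rfl⟩)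

end Essential

end Osofsky
section OsofskyQuotient

variable {A : Type u} [Ring A] {P : Type v} [AddCommGroup P] [Module A P] {I : Submodule A P}

theorem exists_pairwise_disjoint_infinite :
    ∃ B : ℕ → Set ℕ, Pairwise (Function.onFun Disjoint B) ∧ ∀ j, (B j).Infinite := by
  refine ⟨fun j => {k | k.unpair.1 = j}, fun i j hij => Set.disjoint_left.2 ?_, fun j => ?_⟩
  · rintro k rfl hj
    exact hij hj
  · exact Set.infinite_of_injective_forall_mem (f := Nat.pair j)
      (fun m n h => (Nat.pair_eq_pair.1 h).2) fun n => by simp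

theorem IsRegularModule.not_isNoetherian_and_not_injective_quotient [Module.Finite A P]
    [Module.Injective A P] (hP : IsRegularModule A P) (hqp : IsQuasiProjective A P)
    (hI : IsCountablyGenerated I) (hess : IsEssential I) (htop : I ≠ ⊤) :
    ¬ IsNoetherian A (P ⧸ I) ∧ ¬ Module.Injective A (P ⧸ I) := by
  obtain ⟨Q, hQ, hfg, hne, rfl⟩ := hP.exists_iSupIndep_of_isCountablyGenerated hI
    fun hfg => htop (hP.eq_top_of_fg_of_isEssential hfg hess)
  obtain ⟨B, hB, hBinf⟩ := exists_pairwise_disjoint_infinite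
  choose θ hθ using fun j => exists_isBlockProjection hQ (B j)
  exact ⟨not_isNoetherian_quotient_iSup hP hqp hess hB hθ hQ hne hBinf,
    not_injective_quotient_iSup hP hqp hess hB hθ hQ hfg hne hBinf⟩

/-- A nonzero injective submodule `D` of `P ⧸ I` is itself of the form `B ⧸ I'` with `B` a summand
of `P`: take `B` to be the range of a lift of a projection onto `D`. -/
theorem IsRegularModule.not_injective_submodule_quotient [Module.Finite A P]
    [Module.Injective A P] (hP : IsRegularModule A P) (hqp : IsQuasiProjective A P)
    (hI : IsCountablyGenerated I) (hess : IsEssential I) {D : Submodule A (P ⧸ I)} (hD : D ≠ ⊥) :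
    ¬ Module.Injective A D := by
  intro hDinj
  obtain ⟨d, hd⟩ := isDirectSummand_iff_exists_isProj.1 (isDirectSummand_of_injective D)
  obtain ⟨g, hg⟩ := hqp _ I.mkQ (d ∘ₗ I.mkQ) I.mkQ_surjective
  have hg' : ∀ p, I.mkQ (g p) = d (I.mkQ p) := LinearMap.congr_fun hg
  have hBfg : (LinearMap.range g).FG := Module.Finite.iff_fg.1 inferInstance
  have hBsum := hP _ hBfg
  have : Module.Finite A (LinearMap.range g) := Module.Finite.iff_fg.2 hBfg
  have : Module.Injective A (LinearMap.range g) := injective_of_isDirectSummand hBsum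
  let φ : LinearMap.range g →ₗ[A] D := (I.mkQ ∘ₗ (LinearMap.range g).subtype).codRestrict D (by
    rintro ⟨_, p, rfl⟩
    exact (hg' p).symm ▸ hd.map_mem _)
  have hφ : Function.Surjective φ := by
    rintro ⟨x, hx⟩
    obtain ⟨p, rfl⟩ := I.mkQ_surjective x
    exact ⟨⟨g p, p, rfl⟩, Subtype.ext ((hg' p).trans (hd.map_id _ hx))⟩
  have hker : LinearMap.ker φ = I.comap (LinearMap.range g).subtype := by
    rw [LinearMap.ker_codRestrict, LinearMap.ker_comp, Submodule.ker_mkQ]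
  refine ((hP.submodule _).not_isNoetherian_and_not_injective_quotient
    (hqp.of_isDirectSummand hBsum) (hP.isCountablyGenerated_comap_subtype hqp hI hBfg)
    (hess.comap_subtype _) fun htop => ?_).2
    (hker ▸ injective_of_linearEquiv (φ.quotKerEquivOfSurjective hφ).symm)
  have := Submodule.nontrivial_iff_ne_bot.2 hD
  obtain ⟨y, hy⟩ := exists_ne (0 : D)
  obtain ⟨x, rfl⟩ := hφ y
  exact hy (LinearMap.ker_eq_top.1 (hker.trans htop) ▸ rfl)

end OsofskyQuotient

section SimpleSubmodules

variable {A P : Type u} [Ring A] [AddCommGroup P] [Module A P]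

theorem IsRegularModule.exists_isSimpleModule_of_injective (hA : FiniteSemisimpleOrInjective A)
    [Module.Finite A P] [Module.Injective A P] [Nontrivial P] (hP : IsRegularModule A P)
    (hqp : IsQuasiProjective A P) : ∃ S : Submodule A P, IsSimpleModule A S := by
  by_cases hN : IsNoetherian A P
  · have : ComplementedLattice (Submodule A P) := ⟨fun X => hP X (IsNoetherian.noetherian X)⟩
    have : IsSemisimpleModule A P := ⟨⟩
    exact IsSemisimpleModule.exists_simple_submodule A P
  exfalso
  obtain ⟨I, hI, hIfg⟩ := exists_isCountablyGenerated_not_fg_of_not_isNoetherian hN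
  obtain ⟨Z, hIZ, hZ, hess⟩ := exists_isDirectSummand_isEssential_comap I
  have : Module.Finite A Z := finite_of_isDirectSummand hZ
  have : Module.Injective A Z := injective_of_isDirectSummand hZ
  have hZfg : Z.FG := Module.Finite.iff_fg.1 inferInstance
  have hcg := hP.isCountablyGenerated_comap_subtype hqp hI hZfg
  have htop : I.comap Z.subtype ≠ ⊤ := fun h =>
    hIfg (le_antisymm hIZ (Submodule.comap_subtype_eq_top.1 h) ▸ hZfg)
  have hPZ := hP.submodule Z
  have hqpZ := hqp.of_isDirectSummand hZ
  rcases hA (Z ⧸ I.comap Z.subtype) with hss | ⟨D, hD, hDinj⟩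
  · exact (hPZ.not_isNoetherian_and_not_injective_quotient hqpZ hcg hess htop).1 inferInstance
  · exact hPZ.not_injective_submodule_quotient hqpZ hcg hess hD hDinj

theorem IsRegularModule.exists_isSimpleModule (hA : FiniteSemisimpleOrInjective A)
    [Module.Finite A P] [Nontrivial P] (hP : IsRegularModule A P)
    (hqp : IsQuasiProjective A P) : ∃ S : Submodule A P, IsSimpleModule A S := by
  rcases hA P with hss | ⟨D, hD, hDinj⟩
  · exact IsSemisimpleModule.exists_simple_submodule A P
  · have hDsum : IsDirectSummand D := isDirectSummand_of_injective D
    have : Module.Finite A D := finite_of_isDirectSummand hDsum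
    have : Nontrivial D := Submodule.nontrivial_iff_ne_bot.2 hD
    obtain ⟨S, hS⟩ := (hP.submodule D).exists_isSimpleModule_of_injective hA
      (hqp.of_isDirectSummand hDsum)
    exact ⟨S.map D.subtype, IsSimpleModule.congr
      (Submodule.equivMapOfInjective D.subtype D.injective_subtype S).symm⟩

theorem IsRegularModule.exists_isSimpleModule_quotient (hA : FiniteSemisimpleOrInjective A)
    [Module.Finite A P] (hP : IsRegularModule A P) (hqp : IsQuasiProjective A P)
    {X : Submodule A P} (hX : X ≠ ⊤) (hinv : ∀ f : P →ₗ[A] P, X ≤ X.comap f) :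
    ∃ S : Submodule A (P ⧸ X), IsSimpleModule A S := by
  have : Nontrivial (P ⧸ X) := Submodule.Quotient.nontrivial_iff.2 hX
  exact (hP.quotient hinv).exists_isSimpleModule hA (hqp.quotient hinv)

end SimpleSubmodules

section SimpleInjective

theorem IsRegularModule.exists_smul_eq {A : Type u} [Ring A] {S : Type v} [AddCommGroup S]
    [Module A S] (hA : IsRegularModule A A) {F : Submodule A A} (hF : F.FG) (g : F →ₗ[A] S) :
    ∃ s : S, ∀ x : F, (x : A) • s = g x := by
  obtain ⟨r, hr⟩ := exists_retraction_of_isDirectSummand (hA F hF)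
  refine ⟨g (r 1), fun x => ?_⟩
  rw [← map_smul, ← map_smul, smul_eq_mul, mul_one, hr x]

theorem IsRegularModule.exists_seq_of_not_baer {A : Type u} [Ring A] {S : Type v}
    [AddCommGroup S] [Module A S] (hA : IsRegularModule A A) (hS : ¬ Module.Baer A S) :
    ∃ (b : ℕ → A) (z c : ℕ → S), (∀ n, b n • z n ≠ c n) ∧ ∀ m n, m < n → b m • z n = c m := by
  classical
  simp only [Module.Baer, not_forall] at hS
  obtain ⟨I, g, hg⟩ := hS
  have hstep : ∀ s : Finset (I × S), ∃ p : I × S, (p.1 : A) • p.2 ≠ g p.1 ∧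
      ∀ q ∈ s, (q.1 : A) • p.2 = g q.1 := fun s => by
    let F : Submodule A A := Submodule.span A (s.image fun q => (q.1 : A))
    have hFI : F ≤ I := Submodule.span_le.2 fun x hx => by
      obtain ⟨q, -, rfl⟩ := Finset.mem_image.1 hx
      exact q.1.2
    obtain ⟨z, hz⟩ := hA.exists_smul_eq ⟨_, rfl⟩ (g ∘ₗ Submodule.inclusion hFI)
    obtain ⟨b, hb⟩ : ∃ b : I, (b : A) • z ≠ g b := by
      by_contra! h
      exact hg ⟨LinearMap.toSpanSingleton A S z, fun x hx => h ⟨x, hx⟩⟩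
    exact ⟨(b, z), hb, fun q hq =>
      hz ⟨q.1, Submodule.subset_span (Finset.mem_image_of_mem _ hq)⟩⟩
  obtain ⟨p, hne, heq⟩ := exists_seq_of_forall_finset_exists
    (fun p : I × S => (p.1 : A) • p.2 ≠ g p.1) (fun q p => (q.1 : A) • p.2 = g q.1)
    fun s _ => hstep s
  exact ⟨fun n => (p n).1, fun n => (p n).2, fun n => g (p n).1, hne, heq⟩

/-- The sequences constant from `n` on form an ascending chain of submodules, and `b n • z` is
constant from `n + 1` on but not from `n` on. -/
theorem not_isNoetherian_span_of_seq {A : Type u} [Ring A] {S : Type v} [AddCommGroup S]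
    [Module A S] {b : ℕ → A} {z c : ℕ → S} (hne : ∀ n, b n • z n ≠ c n)
    (heq : ∀ m n, m < n → b m • z n = c m) :
    ¬ IsNoetherian A (Submodule.span A {z}) := by
  intro hN
  let W : ℕ →o Submodule A (Submodule.span A {z}) :=
    { toFun := fun n =>
        { carrier := {w | ∀ m, n ≤ m → w.1 m = w.1 n}
          add_mem' := fun {v w} hv hw m hm => congrArg₂ (· + ·) (hv m hm) (hw m hm)
          zero_mem' := fun _ _ => rfl
          smul_mem' := fun r w hw m hm => congrArg (r • ·) (hw m hm) }
      monotone' := fun n n' h w hw m hm => (hw m (h.trans hm)).trans (hw n' h).symm }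
  obtain ⟨n, hn⟩ := monotone_stabilizes_iff_noetherian.2 hN W
  let w : Submodule.span A {z} :=
    ⟨b n • z, Submodule.smul_mem _ _ (Submodule.mem_span_singleton_self z)⟩
  have hw : w ∈ W (n + 1) := fun m hm =>
    (heq n m hm).trans (heq n (n + 1) n.lt_succ_self).symm
  rw [← hn (n + 1) n.le_succ] at hw
  exact hne n ((hw (n + 1) n.le_succ).symm.trans (heq n (n + 1) n.lt_succ_self))

section Reject

variable {A : Type u} [Ring A] {P S : Type*} [AddCommGroup P] [Module A P] [AddCommGroup S]
  [Module A S]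

/-- The reject of `S` in `P`: the elements killed by every homomorphism from `P` to `S`. -/
def reject (A : Type u) [Ring A] (P S : Type*) [AddCommGroup P] [Module A P] [AddCommGroup S]
    [Module A S] : Submodule A P :=
  ⨅ f : P →ₗ[A] S, LinearMap.ker f

theorem mem_reject {x : P} : x ∈ reject A P S ↔ ∀ f : P →ₗ[A] S, f x = 0 := by
  simp only [reject, Submodule.mem_iInf, LinearMap.mem_ker]

theorem reject_le_comap (f : P →ₗ[A] P) : reject A P S ≤ (reject A P S).comap f :=
  fun _ hx => mem_reject.2 fun g => mem_reject.1 hx (g ∘ₗ f)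

theorem reject_self_ne_top [Nontrivial S] : reject A A S ≠ ⊤ := by
  obtain ⟨s, hs⟩ := exists_ne (0 : S)
  intro htop
  have h1 : (1 : A) ∈ reject A A S := htop ▸ Submodule.mem_top
  exact hs (by simpa using mem_reject.1 h1 (LinearMap.toSpanSingleton A S s))

theorem reject_le_ker {ι D : Type*} [AddCommGroup D] [Module A D] {j : D →ₗ[A] ι → S}
    (hj : Function.Injective j) (f : P →ₗ[A] D) : reject A P S ≤ LinearMap.ker f :=
  fun _ hx => (map_eq_zero_iff j hj).1
    (funext fun i => mem_reject.1 hx (LinearMap.proj i ∘ₗ j ∘ₗ f))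

theorem exists_comp_ne_zero_of_submodule_quotient_reject [Module.Projective A P] {ι D : Type*}
    [AddCommGroup D] [Module A D] {j : D →ₗ[A] ι → S} (hj : Function.Injective j)
    {π : D →ₗ[A] S} (hπ : Function.Surjective π) {U : Submodule A (P ⧸ reject A P S)}
    (hU : U ≠ ⊥) : ∃ k : U →ₗ[A] D, π ∘ₗ k ≠ 0 := by
  obtain ⟨u, hu, hu0⟩ := Submodule.exists_mem_ne_zero_of_ne_bot hU
  obtain ⟨p, rfl⟩ := (reject A P S).mkQ_surjective u
  obtain ⟨f, hf⟩ : ∃ f : P →ₗ[A] S, f p ≠ 0 := by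
    by_contra! h
    exact hu0 ((Submodule.Quotient.mk_eq_zero _).2 (mem_reject.2 h))
  obtain ⟨f', rfl⟩ := Module.projective_lifting_property π f hπ
  exact ⟨(reject A P S).liftQ f' (reject_le_ker hj f') ∘ₗ U.subtype,
    fun h0 => hf (LinearMap.congr_fun h0 ⟨_, hu⟩)⟩

end Reject

variable {A : Type u} [Ring A] {S D : Type u} [AddCommGroup S] [Module A S] [IsSimpleModule A S]
  [AddCommGroup D] [Module A D]

theorem injective_of_injective_embedded_in_power (hA : FiniteSemisimpleOrInjective A)
    (hR : IsRegularModule A A) {ι : Type*} [Nontrivial D] [Module.Injective A D]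
    {j : D →ₗ[A] ι → S} (hj : Function.Injective j) : Module.Injective A S := by
  obtain ⟨d, hd⟩ := exists_ne (0 : D)
  obtain ⟨i, hi⟩ := Function.ne_iff.1 ((map_ne_zero_iff j hj).2 hd)
  have hπ : Function.Surjective (LinearMap.proj i ∘ₗ j) :=
    LinearMap.surjective_of_ne_zero fun h0 => hi (LinearMap.congr_fun h0 d)
  have := IsSimpleModule.nontrivial A S
  obtain ⟨U, hU⟩ := hR.exists_isSimpleModule_quotient hA isQuasiProjective_of_projective
    reject_self_ne_top (reject_le_comap (S := S))
  have := IsSimpleModule.nontrivial A U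
  obtain ⟨k, hk⟩ := exists_comp_ne_zero_of_submodule_quotient_reject hj hπ
    (Submodule.nontrivial_iff_ne_bot.1 this)
  let e : U ≃ₗ[A] S := LinearEquiv.ofBijective _ (LinearMap.bijective_of_ne_zero hk)
  exact injective_of_retract (k ∘ₗ e.symm.toLinearMap) (LinearMap.proj i ∘ₗ j) e.apply_symm_apply

theorem injective_of_isSimpleModule (hA : FiniteSemisimpleOrInjective A)
    (hR : IsRegularModule A A) : Module.Injective A S := by
  by_contra hS
  obtain ⟨b, z, c, hne, heq⟩ := hR.exists_seq_of_not_baer fun h => hS h.injective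
  rcases hA (Submodule.span A {z}) with hss | ⟨D, hD, hDinj⟩
  · exact not_isNoetherian_span_of_seq hne heq inferInstance
  · have : Nontrivial D := Submodule.nontrivial_iff_ne_bot.2 hD
    have hj : Function.Injective ((Submodule.span A {z}).subtype ∘ₗ D.subtype) :=
      Subtype.val_injective.comp Subtype.val_injective
    exact hS (injective_of_injective_embedded_in_power (S := S) (D := D) hA hR hj)

end SimpleInjective

section VModules

variable {A : Type u} [Ring A] {G M : Type u} [AddCommGroup G] [Module A G] [AddCommGroup M]
  [Module A M]

theorem exists_isCoatom_notMem_of_ne_zero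
    (h : ∀ (S : Type u) [AddCommGroup S] [Module A S] [IsSimpleModule A S], Module.Injective A S)
    {x : M} (hx : x ≠ 0) : ∃ K : Submodule A M, IsCoatom K ∧ x ∉ K := by
  let L : Submodule A M := Submodule.span A {x}
  let y : L := ⟨x, Submodule.mem_span_singleton_self x⟩
  have : Nontrivial L :=
    Submodule.nontrivial_iff_ne_bot.2 (Submodule.span_singleton_eq_bot.not.2 hx)
  obtain ⟨m, hm, -⟩ := (eq_top_or_exists_le_coatom (⊥ : Submodule A L)).resolve_left bot_ne_top
  have hym : y ∉ m := fun hym => hm.1 (eq_top_iff.2 fun ⟨z, hz⟩ _ => by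
    obtain ⟨a, rfl⟩ := Submodule.mem_span_singleton.1 hz
    exact m.smul_mem a hym)
  have : IsSimpleModule A (L ⧸ m) := isSimpleModule_iff_isCoatom.2 hm
  have := h (L ⧸ m)
  obtain ⟨k, hk⟩ := Module.Injective.out L.subtype L.injective_subtype m.mkQ
  have hkx : k x ≠ 0 := fun h0 =>
    hym ((Submodule.Quotient.mk_eq_zero m).1 ((hk y).symm.trans h0))
  exact ⟨LinearMap.ker k, LinearMap.isCoatom_ker_of_surjective
    (LinearMap.surjective_of_ne_zero fun h0 => hkx (LinearMap.congr_fun h0 x)), hkx⟩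

theorem isVModule_of_injective_of_isSimpleModule
    (h : ∀ (S : Type u) [AddCommGroup S] [Module A S] [IsSimpleModule A S],
      Module.Injective A S) : IsVModule A G := by
  refine fun N _ => ⟨{K | IsCoatom K ∧ N ≤ K}, fun K hK => hK.1,
    le_antisymm (fun x hx => ?_) (le_sInf fun K hK => hK.2)⟩
  by_contra hxN
  obtain ⟨K, hK, hxK⟩ := exists_isCoatom_notMem_of_ne_zero h
    ((Submodule.Quotient.mk_eq_zero N).not.2 hxN)
  exact hxK (Submodule.mem_sInf.1 hx (K.comap N.mkQ)
    ⟨Submodule.isCoatom_comap_iff N.mkQ_surjective |>.2 hK, Submodule.le_comap_mkQ N K⟩)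

theorem exists_isCoatom_notMem_of_isVModule (hG : IsVModule A G) {N : Submodule A G} {x : G}
    (hx : x ∉ N) : ∃ m : Submodule A G, IsCoatom m ∧ N ≤ m ∧ x ∉ m := by
  obtain ⟨s, hs, rfl⟩ := hG N fun h => hx (h ▸ Submodule.mem_top)
  obtain ⟨m, hms, hxm⟩ : ∃ m ∈ s, x ∉ m := by
    simpa only [Submodule.mem_sInf, not_forall, exists_prop] using hx
  exact ⟨m, hs m hms, sInf_le hms, hxm⟩

theorem exists_comp_eq_of_ker_le {N S : Type*} [AddCommGroup N] [Module A N] [AddCommGroup S]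
    [Module A S] {φ : M →ₗ[A] N} (hφ : Function.Surjective φ) {f : M →ₗ[A] S}
    (h : LinearMap.ker φ ≤ LinearMap.ker f) : ∃ ψ : N →ₗ[A] S, ψ ∘ₗ φ = f := by
  refine ⟨(LinearMap.ker φ).liftQ f h ∘ₗ (φ.quotKerEquivOfSurjective hφ).symm.toLinearMap,
    LinearMap.ext fun x => ?_⟩
  have hx : (φ.quotKerEquivOfSurjective hφ).symm (φ x) = (LinearMap.ker φ).mkQ x :=
    (LinearEquiv.symm_apply_eq _).2 rfl
  rw [LinearMap.comp_apply, LinearMap.comp_apply, LinearEquiv.coe_coe, hx, Submodule.mkQ_apply,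
    Submodule.liftQ_apply]

variable {S : Type u} [AddCommGroup S] [Module A S] [IsSimpleModule A S]

theorem exists_extension_of_isVModule (hG : IsVModule A G) {I : Submodule A G} (f : I →ₗ[A] S) :
    ∃ F : G →ₗ[A] S, F ∘ₗ I.subtype = f := by
  by_cases hf : f = 0
  · exact ⟨0, by rw [hf, LinearMap.zero_comp]⟩
  obtain ⟨i, hi⟩ := DFunLike.ne_iff.1 hf
  have hiK : (i : G) ∉ (LinearMap.ker f).map I.subtype := by
    rintro ⟨j, hj, hji⟩
    exact hi (Subtype.ext hji ▸ hj)
  obtain ⟨m, hm, hKm, him⟩ := exists_isCoatom_notMem_of_isVModule hG hiK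
  have : IsSimpleModule A (G ⧸ m) := isSimpleModule_iff_isCoatom.2 hm
  let φ : I →ₗ[A] G ⧸ m := m.mkQ ∘ₗ I.subtype
  have hker : LinearMap.ker φ = m.comap I.subtype := by rw [LinearMap.ker_comp, m.ker_mkQ]
  have hle : LinearMap.ker f ≤ LinearMap.ker φ := hker ▸ Submodule.map_le_iff_le_comap.1 hKm
  have hφi : i ∉ LinearMap.ker φ := hker ▸ him
  have hφ : Function.Surjective φ :=
    LinearMap.surjective_of_ne_zero fun h0 => hφi (LinearMap.congr_fun h0 i)
  have hfmax : IsCoatom (LinearMap.ker f) :=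
    LinearMap.isCoatom_ker_of_surjective (LinearMap.surjective_of_ne_zero hf)
  have heq : LinearMap.ker φ = LinearMap.ker f :=
    (hfmax.le_iff.1 hle).resolve_left fun h0 => hφi (h0 ▸ Submodule.mem_top)
  obtain ⟨ψ, hψ⟩ := exists_comp_eq_of_ker_le hφ heq.le
  exact ⟨ψ ∘ₗ m.mkQ, hψ⟩

theorem injective_of_isSimpleModule_of_isVModule (hG : IsVModule A G) (e : A ≃ₗ[A] G) :
    Module.Injective A S := by
  refine Module.Baer.injective fun I f => ?_
  obtain ⟨F, hF⟩ := exists_extension_of_isVModule hG (f ∘ₗ (e.submoduleMap I).symm.toLinearMap)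
  refine ⟨F ∘ₗ e.toLinearMap, fun x hx => ?_⟩
  simpa using LinearMap.congr_fun hF (e.submoduleMap I ⟨x, hx⟩)

end VModules

section Loewy

variable {A : Type u} [Ring A] {G : Type v} [AddCommGroup G] [Module A G]

theorem loewySeries_zero : loewySeries A G 0 = ⊥ :=
  Ordinal.limitRecOn_zero ..

theorem loewySeries_add_one (α : Ordinal.{v}) :
    loewySeries A G (α + 1) =
      (socle A (G ⧸ loewySeries A G α)).comap (loewySeries A G α).mkQ :=
  Ordinal.limitRecOn_add_one ..

theorem loewySeries_limit {α : Ordinal.{v}} (hα : Order.IsSuccLimit α) :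
    loewySeries A G α = ⨆ γ : Set.Iio α, loewySeries A G γ :=
  Ordinal.limitRecOn_limit _ _ _ _ hα

theorem le_socle {S : Submodule A G} (hS : IsSimpleModule A S) : S ≤ socle A G :=
  le_sSup hS

theorem socle_le_comap {M : Type*} [AddCommGroup M] [Module A M] (f : G →ₗ[A] M) :
    socle A G ≤ (socle A M).comap f := by
  refine sSup_le fun S hS x hx => ?_
  have : IsSimpleModule A S := hS
  rcases (f ∘ₗ S.subtype).injective_or_eq_zero with hinj | h0
  · exact le_socle (IsSimpleModule.congr (LinearEquiv.ofInjective _ hinj).symm) ⟨⟨x, hx⟩, rfl⟩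
  · have hfx : f x = 0 := LinearMap.congr_fun h0 ⟨x, hx⟩
    exact Submodule.mem_comap.2 (hfx ▸ zero_mem _)

theorem loewySeries_le_comap (α : Ordinal.{v}) (f : G →ₗ[A] G) :
    loewySeries A G α ≤ (loewySeries A G α).comap f := by
  induction α using Ordinal.limitRecOn with
  | zero => rw [loewySeries_zero]; exact bot_le
  | add_one α ih =>
    rw [loewySeries_add_one]
    exact fun x hx => socle_le_comap ((loewySeries A G α).mapQ (loewySeries A G α) f ih) hx
  | limit α hα ih =>
    rw [loewySeries_limit hα]
    exact iSup_le fun γ => (ih γ.1 γ.2).trans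
      (Submodule.comap_mono (le_iSup (fun γ : Set.Iio α => loewySeries A G γ) γ))

theorem loewySeries_lt_add_one {α : Ordinal.{v}} {S : Submodule A (G ⧸ loewySeries A G α)}
    (hS : IsSimpleModule A S) : loewySeries A G α < loewySeries A G (α + 1) := by
  rw [loewySeries_add_one]
  refine lt_of_le_of_ne (Submodule.le_comap_mkQ _ _) fun heq => ?_
  have hbot : socle A (G ⧸ loewySeries A G α) = ⊥ := by
    rw [← Submodule.map_comap_eq_of_surjective (loewySeries A G α).mkQ_surjective
      (socle A (G ⧸ loewySeries A G α)), ← heq, Submodule.mkQ_map_self]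
  have := IsSimpleModule.nontrivial A S
  exact Submodule.nontrivial_iff_ne_bot.1 this (le_bot_iff.1 (hbot ▸ le_socle hS))

theorem strictMono_loewySeries
    (h : ∀ α : Ordinal.{v}, loewySeries A G α < loewySeries A G (α + 1)) :
    StrictMono (loewySeries A G) := by
  intro α β hαβ
  induction β using Ordinal.limitRecOn with
  | zero => exact absurd hαβ not_lt_zero
  | add_one β ih =>
    rcases (Order.lt_add_one_iff.1 hαβ).lt_or_eq with hlt | rfl
    · exact (ih hlt).trans (h β)
    · exact h α
  | limit β hβ _ =>
    refine (h α).trans_le ?_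
    rw [loewySeries_limit hβ]
    exact le_iSup (fun γ : Set.Iio β => loewySeries A G γ) ⟨α + 1, hβ.add_one_lt hαβ⟩

theorem isSemiartinian_of_exists_isSimpleModule
    (h : ∀ X : Submodule A G, X ≠ ⊤ → (∀ f : G →ₗ[A] G, X ≤ X.comap f) →
      ∃ S : Submodule A (G ⧸ X), IsSimpleModule A S) : IsSemiartinian A G := by
  by_contra hG
  have hlt : ∀ α : Ordinal.{v}, loewySeries A G α < loewySeries A G (α + 1) := fun α => by
    obtain ⟨S, hS⟩ := h _ (fun htop => hG ⟨α, htop⟩) (loewySeries_le_comap α)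
    exact loewySeries_lt_add_one hS
  exact not_injective_of_ordinal _ (strictMono_loewySeries hlt).injective

theorem exists_isSimpleModule_of_isSemiartinian {M : Type*} [AddCommGroup M] [Module A M]
    (hG : IsSemiartinian A G) {f : G →ₗ[A] M} (hf : f ≠ 0) :
    ∃ S : Submodule A M, IsSimpleModule A S := by
  by_contra! hM
  have hsoc : socle A M = ⊥ := sSup_eq_bot.2 fun S hS => absurd hS (hM S)
  have hker : ∀ α : Ordinal.{v}, loewySeries A G α ≤ LinearMap.ker f := fun α => by
    induction α using Ordinal.limitRecOn with
    | zero => rw [loewySeries_zero]; exact bot_le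
    | add_one α ih =>
      rw [loewySeries_add_one]
      exact fun x hx =>
        (Submodule.mem_bot A).1 (hsoc ▸ socle_le_comap ((loewySeries A G α).liftQ f ih) hx)
    | limit α hα ih =>
      rw [loewySeries_limit hα]
      exact iSup_le fun γ => ih γ.1 γ.2
  obtain ⟨α, hα⟩ := hG
  exact hf (LinearMap.ker_eq_top.1 (top_le_iff.1 (hα ▸ hker α)))

end Loewy

section SVModules

variable {A : Type u} [Ring A] {G M : Type u} [AddCommGroup G] [Module A G] [AddCommGroup M]
  [Module A M]

theorem exists_isDirectSummand_le (hs : IsSemiartinian A G) (hV : IsVModule A G)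
    (e : A ≃ₗ[A] G) {N : Submodule A M} (hN : N ≠ ⊥) :
    ∃ S ≤ N, S ≠ ⊥ ∧ IsDirectSummand S := by
  obtain ⟨x, hx, hx0⟩ := Submodule.exists_mem_ne_zero_of_ne_bot hN
  let f : G →ₗ[A] N := LinearMap.toSpanSingleton A N ⟨x, hx⟩ ∘ₗ e.symm.toLinearMap
  have hfx : f (e 1) = ⟨x, hx⟩ := by simp [f]
  have hf : f ≠ 0 := fun h0 =>
    hx0 (congrArg Subtype.val (hfx.symm.trans (LinearMap.congr_fun h0 (e 1))))
  obtain ⟨S, hS⟩ := exists_isSimpleModule_of_isSemiartinian hs hf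
  have : IsSimpleModule A (S.map N.subtype) := IsSimpleModule.congr
    (Submodule.equivMapOfInjective N.subtype N.injective_subtype S).symm
  have hinj : Module.Injective A (S.map N.subtype) :=
    injective_of_isSimpleModule_of_isVModule hV e
  exact ⟨S.map N.subtype, Submodule.map_subtype_le N S,
    Submodule.nontrivial_iff_ne_bot.1 (IsSimpleModule.nontrivial A _),
    isDirectSummand_of_injective _⟩

theorem isI0Module_of_isSemiartinian_of_isVModule (hs : IsSemiartinian A G)
    (hV : IsVModule A G) (e : A ≃ₗ[A] G) : IsI0Module A M :=
  fun _ hN => exists_isDirectSummand_le hs hV e fun h0 => hN fun X hX => by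
    rwa [h0, bot_sup_eq] at hX

/-- If `K ≠ ⊥`, then `0` is a valid `h'` on a nonzero summand of `N` inside `K`. -/
theorem isAlmostProjective_of_isSemiartinian_of_isVModule (hs : IsSemiartinian A G)
    (hV : IsVModule A G) (e : A ≃ₗ[A] G) : IsAlmostProjective A M := by
  intro N _ _ K f
  by_cases hK : K = ⊥
  · subst hK
    exact Or.inl ⟨(Submodule.quotEquivOfEqBot ⊥ rfl).toLinearMap ∘ₗ f, LinearMap.ext fun x =>
      ((Submodule.quotEquivOfEqBot ⊥ rfl).symm_apply_apply (f x)).symm⟩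
  · obtain ⟨S, hSK, hS0, hS⟩ := exists_isDirectSummand_le hs hV e hK
    exact Or.inr ⟨S, hS0, hS, 0, LinearMap.ext fun x =>
      ((Submodule.Quotient.mk_eq_zero K).2 (hSK x.2)).trans (map_zero f).symm⟩

theorem IsRegularModule.of_linearEquiv (hG : IsRegularModule A G) (e : G ≃ₗ[A] M) :
    IsRegularModule A M := by
  intro N hN
  obtain ⟨C, hC⟩ := hG _ (hN.map e.symm.toLinearMap)
  refine ⟨C.map e.toLinearMap, ?_⟩
  have := (Submodule.orderIsoMapComap e).isCompl hC
  simpa [← Submodule.map_comp] using this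

theorem isSemiartinian_and_isVModule (hA : IsVonNeumannRegularRing A)
    (h : FiniteSemisimpleOrInjective A) (e : A ≃ₗ[A] G) :
    IsSemiartinian A G ∧ IsVModule A G := by
  have hR := isRegularModule_self hA
  have : Module.Finite A G := Module.Finite.equiv e
  have : Module.Projective A G := Module.Projective.of_equiv e
  exact ⟨isSemiartinian_of_exists_isSimpleModule fun X hX hinv =>
    (hR.of_linearEquiv e).exists_isSimpleModule_quotient h isQuasiProjective_of_projective hX hinv,
    isVModule_of_injective_of_isSimpleModule fun _ _ _ _ => injective_of_isSimpleModule h hR⟩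

end SVModules

theorem isVonNeumannRegularRing_mulOpposite {R : Type u} [Ring R]
    (hR : IsVonNeumannRegularRing R) : IsVonNeumannRegularRing Rᵐᵒᵖ := fun a => by
  obtain ⟨b, hb⟩ := hR a.unop
  exact ⟨MulOpposite.op b, MulOpposite.unop_injective (by simpa [mul_assoc] using hb)⟩

end SVRing

theorem theorem1p2 (R : Type u) [Ring R] (hR : IsVonNeumannRegularRing R) :
    List.TFAE [
      ∀ (M : Type u) [AddCommGroup M] [Module Rᵐᵒᵖ M], Module.IsI0Module Rᵐᵒᵖ M,
      IsRightSVRing R,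
      ∀ (M : Type u) [AddCommGroup M] [Module Rᵐᵒᵖ M], Module.IsAlmostProjective Rᵐᵒᵖ M,
      ∀ (M : Type u) [AddCommGroup M] [Module Rᵐᵒᵖ M],
        IsSimpleModule Rᵐᵒᵖ M → Module.IsAlmostProjective Rᵐᵒᵖ M] := by
  have hop := SVRing.isVonNeumannRegularRing_mulOpposite hR
  let e : Rᵐᵒᵖ ≃ₗ[Rᵐᵒᵖ] R := (MulOpposite.opLinearEquiv Rᵐᵒᵖ).symm
  tfae_have 1 → 2 := fun h => SVRing.isSemiartinian_and_isVModule hop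
    (SVRing.finiteSemisimpleOrInjective_of_isI0Module h) e
  tfae_have 2 → 1 := fun h _ _ _ =>
    SVRing.isI0Module_of_isSemiartinian_of_isVModule h.1 h.2 e
  tfae_have 2 → 3 := fun h _ _ _ =>
    SVRing.isAlmostProjective_of_isSemiartinian_of_isVModule h.1 h.2 e
  tfae_have 3 → 4 := fun h M _ _ _ => h M
  tfae_have 4 → 2 := fun h => SVRing.isSemiartinian_and_isVModule hop
    (SVRing.finiteSemisimpleOrInjective_of_isAlmostProjective h) e
  tfae_finish
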